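/- Let $X$ be a real Hilbert space and let $A,B\colon X\rightrightarrows X$ be maximally monotone operators, with $\operatorname{dom}A=\{x: Ax\neq\varnothing\}$ and $\operatorname{ran}A=\bigcup_{x\in X}Ax$ (similarly for $B$). Let $J_A=(\mathrm{Id}+A)^{-1}$ and $J_B=(\mathrm{Id}+B)^{-1}$ be the resolvents, $R_A=2J_A-\mathrm{Id}$, and let $T=\mathrm{Id}-J_A+J_BR_A$ be the Douglas--Rachford operator. Put $D=\operatorname{dom}A-\operatorname{dom}B$ and $R=\operatorname{ran}A+\operatorname{ran}B$, and assume that $$\overline{\operatorname{ran}}(\mathrm{Id}-T)=\overline{D}\cap\overline{R}.$$ For $C\subseteq X$ write $\operatorname{rec}C=\{x\in X: x+C\subseteq C\}$ for its recession cone and $C^{\ominus}=\{u\in X:\langle c,u\rangle\le 0\ \text{for all } c\in C\}$ for its polar cone, and let $\overline{\operatorname{dom}}$, $\overline{\operatorname{ran}}$ denote closures of domains and ranges. Then the closed sets $\overline{\operatorname{ran}}(\mathrm{Id}-T)$, $\overline{D}$ and $\overline{R}$ are nonempty and convex, so that the projections of $0$ $$v=P_{\overline{\operatorname{ran}}(\mathrm{Id}-T)}(0),\qquad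 v_D=P_{\overline{D}}(0),\qquad v_R=P_{\overline{R}}(0)$$ are well defined, and the following hold: 1. $v_D\in(-\operatorname{rec}\overline{\operatorname{dom}}A)^{\ominus}\cap(\operatorname{rec}\overline{\operatorname{dom}}B)^{\ominus}=\bigl(-(\operatorname{rec}\overline{\operatorname{dom}}A)^{\ominus}\bigr)\cap(\operatorname{rec}\overline{\operatorname{dom}}B)^{\ominus}$. 2. $v_D\in(-\operatorname{rec}\overline{\operatorname{ran}}A)\cap(\operatorname{rec}\overline{\operatorname{ran}}B)$. 3. $v_R\in(-\operatorname{rec}\overline{\operatorname{ran}}A)^{\ominus}\cap(-\operatorname{rec}\overline{\operatorname{ran}}B)^{\ominus}=-\bigl((\operatorname{rec}\overline{\operatorname{ran}}A)^{\ominus}\cap(\operatorname{rec}\overline{\operatorname{ran}}B)^{\ominus}\bigr)$. 4. $v_R\in(-\operatorname{rec}\overline{\operatorname{dom}}A)\cap(-\operatorname{rec}\overline{\operatorname{dom}}B)=-\bigl(\operatorname{rec}\overline{\operatorname{dom}}A\cap\operatorname{rec}\overline{\operatorname{dom}}B\bigr)$. 5. $\langle v_D,v_R\rangle=0$. 6.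 $v_D+v_R\in\overline{\operatorname{dom}A-\operatorname{dom}B}\cap\overline{\operatorname{ran}A+\operatorname{ran}B}$. 7. $v=v_D+v_R$. 8. $\|v\|^2=\|v_D\|^2+\|v_R\|^2=\|(v_R,v_D)\|^2$, where the last norm is the Hilbert product norm of $X\times X$. -/

import Mathlib

open scoped Pointwise

namespace DRSplit

noncomputable section

variable {X : Type*} [NormedAddCommGroup X] [InnerProductSpace ℝ X]

/-! ### Set-valued operators `X → Set X` -/

/-- The domain `{x | A x ≠ ∅}`. -/
def dom (A : X → Set X) : Set X := {x | (A x).Nonempty}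

/-- The range `⋃ x, A x`. -/
def ran (A : X → Set X) : Set X := ⋃ x, A x

/-- The identity, as a set-valued operator. -/
def opId : X → Set X := fun x => {x}

/-- The inverse: `x ∈ A⁻¹ u` if and only if `u ∈ A x`. -/
def opInv (A : X → Set X) : X → Set X := fun u => {x | u ∈ A x}

/-- The composition `F ∘ G`, that is `x ↦ ⋃ y ∈ G x, F y`. -/
def opComp (F G : X → Set X) : X → Set X := fun x => ⋃ y ∈ G x, F y

/-- Monotone operators. -/
def IsMonotoneOp (A : X → Set X) : Prop :=
  ∀ x y : X, ∀ u ∈ A x, ∀ w ∈ A y, 0 ≤ inner ℝ (x - y) (u - w)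

/-- Maximally monotone operators: monotone, with no monotone proper extension of the graph
(operators are ordered by inclusion of their graphs). -/
def IsMaximallyMonotone (A : X → Set X) : Prop := Maximal IsMonotoneOp A

/-- The resolvent `J_A = (Id + A)⁻¹`. -/
def resolvent (A : X → Set X) : X → Set X := opInv (opId + A)

/-- The reflected resolvent `R_A = 2 J_A - Id`. -/
def reflectedResolvent (A : X → Set X) : X → Set X := (2 : ℝ) • resolvent A - opId

/-- The Douglas--Rachford operator `T = Id - J_A + J_B R_A`. For maximally monotone `A` and `B`,
the values of `J_A` and `J_B`, hence those of `T`, are singletons, and the pointwise operations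
on sets used here are the ordinary ones on single-valued maps. -/
def drOperator (A B : X → Set X) : X → Set X :=
  opId - resolvent A + opComp (resolvent B) (reflectedResolvent A)

/-! ### Metric projections -/

/-- `p` is a nearest point to `x` in `C`. -/
def IsNearestPoint (C : Set X) (x p : X) : Prop := p ∈ C ∧ ∀ y ∈ C, ‖x - p‖ ≤ ‖x - y‖

/-- The projection of `x` onto `C`: the nearest point to `x` in `C`. It exists and is unique if
`C` is nonempty, closed and convex, by `existsUnique_isNearestPoint` below. -/
def proj (C : Set X) (x : X) : X := Classical.epsilon (IsNearestPoint C x)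

theorem existsUnique_isNearestPoint [CompleteSpace X] {C : Set X} (hne : C.Nonempty)
    (hcl : IsClosed C) (hcv : Convex ℝ C) (x : X) : ∃! p, IsNearestPoint C x p := by
  have key : ∀ p, IsNearestPoint C x p → ∀ w ∈ C, inner ℝ (x - p) (w - p) ≤ 0 := by
    rintro p ⟨hp, hmin⟩
    refine (norm_eq_iInf_iff_real_inner_le_zero hcv hp).1 ?_
    have : Nonempty C := ⟨⟨p, hp⟩⟩
    refine le_antisymm (le_ciInf fun w => hmin w w.2) ?_
    exact ciInf_le (f := fun w : C => ‖x - w‖)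
      ⟨0, by rintro _ ⟨w, rfl⟩; exact norm_nonneg _⟩ ⟨p, hp⟩
  obtain ⟨p, hp, hpe⟩ := exists_norm_eq_iInf_of_complete_convex hne hcl.isComplete hcv x
  have hnp : IsNearestPoint C x p := by
    refine ⟨hp, fun y hy => ?_⟩
    rw [hpe]
    exact ciInf_le (f := fun w : C => ‖x - w‖)
      ⟨0, by rintro _ ⟨w, rfl⟩; exact norm_nonneg _⟩ ⟨y, hy⟩
  refine ⟨p, hnp, fun q hq => ?_⟩
  have h1 := key p hnp q hq.1
  have h2 := key q hq p hp
  have h3 : inner ℝ (q - p) (q - p) = inner ℝ (x - p) (q - p) + inner ℝ (x - q) (p - q) := by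
    rw [← neg_sub q p, inner_neg_right, ← sub_eq_add_neg, ← inner_sub_left]
    congr 1
    abel
  have h4 : inner ℝ (q - p) (q - p) = 0 := le_antisymm (by linarith) real_inner_self_nonneg
  exact sub_eq_zero.1 (inner_self_eq_zero.1 h4)

theorem proj_spec [CompleteSpace X] {C : Set X} (hne : C.Nonempty)
    (hcl : IsClosed C) (hcv : Convex ℝ C) (x : X) : IsNearestPoint C x (proj C x) :=
  Classical.epsilon_spec (existsUnique_isNearestPoint hne hcl hcv x).exists

/-! ### Cones -/

/-- The recession cone `{x | x + C ⊆ C}`. -/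
def rec (C : Set X) : Set X := {x | ∀ y ∈ C, x + y ∈ C}

/-- The polar cone `{u | ⟨c, u⟩ ≤ 0 for all c ∈ C}`. -/
def polar (C : Set X) : Set X := {u | ∀ c ∈ C, inner ℝ c u ≤ 0}

/-! ### The displacement vectors -/

/-- `D = dom A - dom B`. -/
def setD (A B : X → Set X) : Set X := dom A - dom B

/-- `R = ran A + ran B`. -/
def setR (A B : X → Set X) : Set X := ran A + ran B

/-- The range of `Id - T`. -/
def ranDisp (A B : X → Set X) : Set X := ran (opId - drOperator A B)

/-- The minimal displacement vector `v`. -/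
def v (A B : X → Set X) : X := proj (closure (ranDisp A B)) 0

/-- The vector `v_D`. -/
def vD (A B : X → Set X) : X := proj (closure (setD A B)) 0

/-- The vector `v_R`. -/
def vR (A B : X → Set X) : X := proj (closure (setR A B)) 0

end

end DRSplit

namespace DRSplit

open Filter Topology

/-! ### Minty's theorem through the Fitzpatrick function. -/

section Minty

/-! A linear functional bounded above on the domain of a maximally monotone operator is a recession
direction of its closed range (`mem_rec_closure_ran`), and dually via the inverse. Since `⟨v_D, ·⟩ ≥
‖v_D‖²` on `closure D`, `-v_D` is bounded above on `dom A` and `v_D` on `dom B`; likewise `-v_R` on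
both ranges. This gives (2) and (4). The polar statements (1) and (3) hold because the projection of
0 pairs nonnegatively with every recession direction. Testing (1) on the directions from (4) gives
orthogonality, recession puts `v_D + v_R` in both closures, and adding the two projection
inequalities shows it is the nearest point of the intersection. The recession lemma and convexity of
the closed range use the regularization `w - l • x ∈ A x` as `l → 0`, solvable by Minty's theorem.
-/

/-- By the parallelogram law, first components of a minimizing sequence are Cauchy; the second
components then converge too. -/
theorem exists_minimizer_add_norm_sq {H : Type*} [NormedAddCommGroup H] [InnerProductSpace ℝ H]
    [CompleteSpace H] {K : Set (H × ℝ)} (hne : K.Nonempty) (hcl : IsClosed K) (hcv : Convex ℝ K)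
    (hbd : ∀ p ∈ K, 0 ≤ p.2 + ‖p.1‖ ^ 2 / 2) :
    ∃ p ∈ K, ∀ q ∈ K, p.2 + ‖p.1‖ ^ 2 / 2 ≤ q.2 + ‖q.1‖ ^ 2 / 2 := by
  set g : H × ℝ → ℝ := fun p => p.2 + ‖p.1‖ ^ 2 / 2 with hg
  set m : ℝ := sInf (g '' K) with hm
  have hbdd : BddBelow (g '' K) := ⟨0, by rintro _ ⟨p, hp, rfl⟩; exact hbd p hp⟩
  have hle : ∀ p ∈ K, m ≤ g p := fun p hp => csInf_le hbdd ⟨p, hp, rfl⟩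
  have hex : ∀ n : ℕ, ∃ p ∈ K, g p < m + 1 / ((n : ℝ) + 1) := by
    intro n
    have hn : m < m + 1 / ((n : ℝ) + 1) := lt_add_of_pos_right _ Nat.one_div_pos_of_nat
    obtain ⟨_, ⟨p, hp, rfl⟩, hlt⟩ := exists_lt_of_csInf_lt (hne.image g) hn
    exact ⟨p, hp, hlt⟩
  choose P hPK hPlt using hex
  have hsq : ∀ a b, ‖(P a).1 - (P b).1‖ ^ 2 ≤ 4 * (1 / ((a : ℝ) + 1) + 1 / ((b : ℝ) + 1)) := by
    intro a b
    have hmid := hle _ (hcv (hPK a) (hPK b) (a := 1 / 2) (b := 1 / 2) (by norm_num) (by norm_num)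
      (by norm_num))
    have hpar := parallelogram_law_with_norm ℝ (P a).1 (P b).1
    have hhalf : ‖(1 / 2 : ℝ) • (P a).1 + (1 / 2 : ℝ) • (P b).1‖
        = (1 / 2) * ‖(P a).1 + (P b).1‖ := by
      rw [← smul_add, norm_smul]; norm_num
    simp only [hg, Prod.fst_add, Prod.snd_add, Prod.smul_fst, Prod.smul_snd, hhalf,
      smul_eq_mul] at hmid
    have ha := hPlt a
    have hb := hPlt b
    simp only [hg] at ha hb
    nlinarith
  have hzero : Tendsto (fun n : ℕ => 1 / ((n : ℝ) + 1)) atTop (𝓝 0) :=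
    tendsto_one_div_add_atTop_nhds_zero_nat
  have hcauchy : CauchySeq fun n => (P n).1 := by
    refine Metric.cauchySeq_iff.2 fun ε hε => ?_
    obtain ⟨N, hN⟩ := (hzero.eventually_lt_const (show (0 : ℝ) < ε ^ 2 / 8 by positivity)
      |> eventually_atTop.1)
    refine ⟨N, fun a ha b hb => ?_⟩
    rw [dist_eq_norm]
    refine lt_of_pow_lt_pow_left₀ 2 hε.le ?_
    linarith [hsq a b, hN a ha, hN b hb]
  obtain ⟨z, hz⟩ := cauchySeq_tendsto_of_complete hcauchy
  have hgm : Tendsto (fun n => g (P n)) atTop (𝓝 m) := by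
    refine tendsto_of_tendsto_of_tendsto_of_le_of_le tendsto_const_nhds
      (by simpa using hzero.const_add m) (fun n => hle _ (hPK n)) fun n => (hPlt n).le
  have hs : Tendsto (fun n => (P n).2) atTop (𝓝 (m - ‖z‖ ^ 2 / 2)) := by
    refine (hgm.sub ((hz.norm.pow 2).div_const 2)).congr fun n => ?_
    simp [hg]
  have hmem : (z, m - ‖z‖ ^ 2 / 2) ∈ K :=
    hcl.mem_of_tendsto (hz.prodMk_nhds hs) (Eventually.of_forall hPK)
  exact ⟨_, hmem, fun q hq => by simpa using hle q hq⟩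

/-- First-order optimality of the minimizer along the segment from `p` to `q`. -/
theorem exists_add_norm_sq_le_add_inner {H : Type*} [NormedAddCommGroup H] [InnerProductSpace ℝ H]
    [CompleteSpace H] {K : Set (H × ℝ)} (hne : K.Nonempty) (hcl : IsClosed K) (hcv : Convex ℝ K)
    (hbd : ∀ p ∈ K, 0 ≤ p.2 + ‖p.1‖ ^ 2 / 2) :
    ∃ p ∈ K, ∀ q ∈ K, p.2 + ‖p.1‖ ^ 2 ≤ q.2 + inner ℝ p.1 q.1 := by
  obtain ⟨p, hp, hmin⟩ := exists_minimizer_add_norm_sq hne hcl hcv hbd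
  refine ⟨p, hp, fun q hq => ?_⟩
  have key : ∀ t : ℝ, 0 < t → t < 1 →
      0 ≤ (q.2 - p.2) + inner ℝ p.1 (q.1 - p.1) + t * (‖q.1 - p.1‖ ^ 2 / 2) := by
    intro t ht ht1
    have h := hmin _ (hcv hp hq (sub_nonneg.2 ht1.le) ht.le (by ring))
    have hz : (1 - t) • p.1 + t • q.1 = p.1 + t • (q.1 - p.1) := by module
    simp only [Prod.fst_add, Prod.snd_add, Prod.smul_fst, Prod.smul_snd, hz, smul_eq_mul] at h
    rw [norm_add_sq_real, inner_smul_right, norm_smul, Real.norm_eq_abs, mul_pow, sq_abs] at h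
    refine nonneg_of_mul_nonneg_right (a := t) ?_ ht
    linarith
  have hlim : Tendsto (fun t : ℝ =>
      (q.2 - p.2) + inner ℝ p.1 (q.1 - p.1) + t * (‖q.1 - p.1‖ ^ 2 / 2)) (𝓝[>] 0)
      (𝓝 ((q.2 - p.2) + inner ℝ p.1 (q.1 - p.1) + 0 * (‖q.1 - p.1‖ ^ 2 / 2))) :=
    (by fun_prop : Continuous fun t : ℝ =>
      (q.2 - p.2) + inner ℝ p.1 (q.1 - p.1) + t * (‖q.1 - p.1‖ ^ 2 / 2)).continuousWithinAt
  have h0 := ge_of_tendsto hlim (by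
    filter_upwards [Ioo_mem_nhdsGT (zero_lt_one' ℝ)] with t ht using key t ht.1 ht.2)
  rw [inner_sub_right, real_inner_self_eq_norm_sq] at h0
  linarith

variable {X : Type*} [NormedAddCommGroup X] [InnerProductSpace ℝ X]

theorem isMaximallyMonotone_iff {A : X → Set X} : IsMaximallyMonotone A ↔
    ∀ x u, u ∈ A x ↔ ∀ y, ∀ w ∈ A y, 0 ≤ inner ℝ (x - y) (u - w) := by
  constructor
  · intro hA x u
    refine ⟨fun hu y w hw => hA.prop x y u hu w hw, fun h => ?_⟩
    have hmono : IsMonotoneOp fun y => A y ∪ {w | y = x ∧ w = u} := by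
      rintro y z w (hw | ⟨rfl, rfl⟩) w' (hw' | ⟨rfl, rfl⟩)
      · exact hA.prop _ _ _ hw _ hw'
      · have := h y w hw
        rwa [← neg_sub y, ← neg_sub w, inner_neg_neg] at this
      · exact h _ _ hw'
      · simp
    exact hA.le_of_ge hmono (fun y => Set.subset_union_left) x (Or.inr ⟨rfl, rfl⟩)
  · intro h
    refine ⟨fun x y u hu w hw => (h x u).1 hu y w hw, fun C hC hAC x u hu => ?_⟩
    exact (h x u).2 fun y w hw => hC x y u hu w (hAC y hw)

theorem IsMaximallyMonotone.exists_mem {A : X → Set X} (hA : IsMaximallyMonotone A) :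
    ∃ x u, u ∈ A x := by
  by_contra! h
  exact h 0 0 ((isMaximallyMonotone_iff.1 hA 0 0).2 fun y w hw => (h y w hw).elim)

theorem IsMaximallyMonotone.inv {A : X → Set X} (hA : IsMaximallyMonotone A) :
    IsMaximallyMonotone (opInv A) := by
  rw [isMaximallyMonotone_iff] at hA ⊢
  intro u x
  refine (hA x u).trans ⟨fun h w y hy => ?_, fun h y w hw => ?_⟩
  · rw [real_inner_comm]; exact h y w hy
  · rw [real_inner_comm]; exact h w y hw

theorem ran_opInv {X : Type*} (A : X → Set X) : ran (opInv A) = dom A := by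
  ext x; simp [ran, dom, opInv, Set.Nonempty]

theorem dom_opInv {X : Type*} (A : X → Set X) : dom (opInv A) = ran A := by
  ext x; simp [ran, dom, opInv, Set.Nonempty]

/-- Optimality over the Fitzpatrick epigraph, tested on graph points, puts `(-p.snd, -p.fst)` in the
graph by maximality. Testing it at that very point forces `p.fst + p.snd = 0`. -/
theorem IsMaximallyMonotone.exists_neg_mem [CompleteSpace X] {A : X → Set X}
    (hA : IsMaximallyMonotone A) : ∃ x, -x ∈ A x := by
  have hmem := isMaximallyMonotone_iff.1 hA
  -- the epigraph of the Fitzpatrick function of `A`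
  let K : Set (WithLp 2 (X × X) × ℝ) := {p | ∀ y, ∀ w ∈ A y,
    inner ℝ p.1.fst w + inner ℝ y p.1.snd - inner ℝ y w ≤ p.2}
  have hgraph : ∀ y, ∀ w ∈ A y, (WithLp.toLp 2 (y, w), inner ℝ y w) ∈ K := by
    intro y w hw y' w' hw'
    have := hA.prop y y' w hw w' hw'
    simp only [inner_sub_left, inner_sub_right] at this
    show inner ℝ y w' + inner ℝ y' w - inner ℝ y' w' ≤ inner ℝ y w
    linarith
  -- Otherwise `p.1` would be monotonically related to the graph, hence in it, and its own epigraph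
  -- inequality would be violated.
  have hfitz : ∀ p ∈ K, inner ℝ p.1.fst p.1.snd ≤ p.2 := by
    intro p hp
    by_contra! hlt
    have hin : p.1.snd ∈ A p.1.fst := by
      refine (hmem _ _).2 fun y w hw => ?_
      have := hp y w hw
      simp only [inner_sub_left, inner_sub_right]
      linarith
    have := hp _ _ hin
    linarith
  have hne : K.Nonempty := by
    obtain ⟨x, u, hu⟩ := hA.exists_mem
    exact ⟨_, hgraph x u hu⟩
  have hcl : IsClosed K := by
    simp only [K, Set.ofPred_forall]
    refine isClosed_iInter fun y => isClosed_iInter fun w => isClosed_iInter fun _ => ?_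
    exact isClosed_le (by fun_prop) (by fun_prop)
  have hcv : Convex ℝ K := by
    intro p hp q hq a b ha hb hab y w hw
    have h1 := mul_le_mul_of_nonneg_left (hp y w hw) ha
    have h2 := mul_le_mul_of_nonneg_left (hq y w hw) hb
    simp only [Prod.fst_add, Prod.snd_add, Prod.smul_fst, Prod.smul_snd, WithLp.add_fst,
      WithLp.add_snd, WithLp.smul_fst, WithLp.smul_snd, inner_add_left, inner_add_right,
      real_inner_smul_left, real_inner_smul_right, smul_eq_mul]
    have h3 : inner ℝ y w = a * inner ℝ y w + b * inner ℝ y w := by rw [← add_mul, hab, one_mul]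
    linarith
  have hbd : ∀ p ∈ K, 0 ≤ p.2 + ‖p.1‖ ^ 2 / 2 := by
    intro p hp
    have h1 := hfitz p hp
    have h2 := norm_add_sq_real p.1.fst p.1.snd
    have h3 := sq_nonneg ‖p.1.fst + p.1.snd‖
    rw [WithLp.prod_norm_sq_eq_of_L2]
    linarith
  obtain ⟨p, hp, hopt⟩ := exists_add_norm_sq_le_add_inner hne hcl hcv hbd
  have hrel : ∀ y, ∀ w ∈ A y,
      ‖p.1.fst + p.1.snd‖ ^ 2 ≤ inner ℝ (-p.1.snd - y) (-p.1.fst - w) := by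
    intro y w hw
    have h1 := hopt _ (hgraph y w hw)
    have h2 := hfitz p hp
    rw [WithLp.prod_norm_sq_eq_of_L2, WithLp.prod_inner_apply] at h1
    simp only [WithLp.ofLp_fst, WithLp.ofLp_snd] at h1
    have h3 := norm_add_sq_real p.1.fst p.1.snd
    simp only [inner_sub_left, inner_sub_right, inner_neg_left, inner_neg_right]
    rw [real_inner_comm p.1.fst p.1.snd, real_inner_comm p.1.fst y]
    linarith
  have hin : -p.1.fst ∈ A (-p.1.snd) :=
    (hmem _ _).2 fun y w hw => (sq_nonneg _).trans (hrel y w hw)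
  have h0 := hrel _ _ hin
  rw [sub_self, inner_zero_left] at h0
  have h1 : p.1.fst + p.1.snd = 0 := norm_eq_zero.1 (pow_eq_zero_iff two_ne_zero |>.1
    (le_antisymm h0 (sq_nonneg _)))
  exact ⟨p.1.fst, by rwa [← eq_neg_of_add_eq_zero_left h1] at hin⟩

theorem IsMaximallyMonotone.exists_sub_smul_mem [CompleteSpace X] {A : X → Set X}
    (hA : IsMaximallyMonotone A) {l : ℝ} (hl : 0 < l) (w : X) : ∃ x, w - l • x ∈ A x := by
  -- The rescaled operator `l⁻¹ (A - w)` reduces the claim to `exists_neg_mem`.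
  have hA' : IsMaximallyMonotone fun x => {u | w + l • u ∈ A x} := by
    rw [isMaximallyMonotone_iff] at hA ⊢
    intro x u
    refine (hA x _).trans ⟨fun h y u' hu' => ?_, fun h y u' hu' => ?_⟩
    · have := h y _ hu'
      rw [add_sub_add_left_eq_sub, ← smul_sub, real_inner_smul_right] at this
      exact nonneg_of_mul_nonneg_right this hl
    · have := h y (l⁻¹ • (u' - w)) (by simpa [smul_smul, hl.ne'] using hu')
      have h2 := mul_nonneg hl.le this
      rw [← real_inner_smul_right, smul_sub, smul_smul, mul_inv_cancel₀ hl.ne', one_smul] at h2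
      rwa [show w + l • u - u' = l • u - (u' - w) by abel]
  obtain ⟨x, hx⟩ := hA'.exists_neg_mem
  exact ⟨x, by simpa [sub_eq_add_neg] using hx⟩

theorem IsMaximallyMonotone.resolvent_nonempty [CompleteSpace X] {A : X → Set X}
    (hA : IsMaximallyMonotone A) (w : X) : (resolvent A w).Nonempty := by
  obtain ⟨x, hx⟩ := hA.exists_sub_smul_mem one_pos w
  refine ⟨x, Set.mem_add.2 ⟨x, rfl, _, hx, ?_⟩⟩
  simp

theorem ranDisp_nonempty [CompleteSpace X] {A B : X → Set X} (hA : IsMaximallyMonotone A)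
    (hB : IsMaximallyMonotone B) : (ranDisp A B).Nonempty := by
  obtain ⟨p, hp⟩ := hA.resolvent_nonempty 0
  obtain ⟨q, hq⟩ := hB.resolvent_nonempty ((2 : ℝ) • p - 0)
  refine ⟨0 - (0 - p + q), Set.mem_iUnion.2 ⟨0, Set.sub_mem_sub rfl
    (Set.add_mem_add (Set.sub_mem_sub rfl hp) (Set.mem_iUnion₂.2 ⟨_, ?_, hq⟩))⟩⟩
  exact Set.sub_mem_sub (Set.smul_mem_smul_set hp) rfl

end Minty

/-! ### Closures of ranges and domains by regularization. -/

section Range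

variable {X : Type*} [NormedAddCommGroup X] [InnerProductSpace ℝ X]

theorem mem_closure_of_forall_exists_norm_sq_le {X : Type*} [NormedAddCommGroup X]
    {S : Set X} {w : X} {C D : ℝ}
    (h : ∀ l : ℝ, 0 < l → l ≤ 1 → ∃ n, w - n ∈ S ∧ ‖n‖ ^ 2 ≤ l * (C + D * ‖n‖)) :
    w ∈ closure S := by
  refine Metric.mem_closure_iff.2 fun ε hε => ?_
  -- Completing the square gives `‖n‖² ≤ 2l|C| + l²D²`, at most `l * M` as `l ≤ 1`.
  set M : ℝ := 2 * |C| + D ^ 2 with hM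
  have hM0 : 0 ≤ M := by positivity
  have hpos : 0 < M + 1 + ε ^ 2 := by positivity
  set l : ℝ := ε ^ 2 / (M + 1 + ε ^ 2) with hl
  have hl0 : 0 < l := by positivity
  have hl1 : l ≤ 1 := (div_le_one hpos).2 (by linarith)
  obtain ⟨n, hn, hle⟩ := h l hl0 hl1
  refine ⟨w - n, hn, ?_⟩
  rw [dist_eq_norm, sub_sub_cancel]
  refine lt_of_pow_lt_pow_left₀ 2 hε.le ?_
  have h1 : ‖n‖ ^ 2 ≤ l * M := by
    have h2 : l * C ≤ l * |C| := mul_le_mul_of_nonneg_left (le_abs_self C) hl0.le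
    have h3 : (l * D) ^ 2 ≤ l * D ^ 2 := by
      rw [mul_pow]; exact mul_le_mul_of_nonneg_right (by nlinarith) (sq_nonneg _)
    nlinarith [sq_nonneg (l * D - ‖n‖)]
  have h4 : l * (M + 1 + ε ^ 2) = ε ^ 2 := div_mul_cancel₀ _ hpos.ne'
  nlinarith [mul_pos hl0 (show (0 : ℝ) < 1 + ε ^ 2 by positivity)]

theorem mem_rec_closure {X : Type*} [NormedAddCommGroup X] {S : Set X} {u : X}
    (h : ∀ y ∈ S, u + y ∈ closure S) :
    u ∈ rec (closure S) := by
  intro y hy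
  have : Set.MapsTo (fun y => u + y) (closure S) (closure (closure S)) :=
    Set.MapsTo.closure h (by fun_prop)
  simpa using this hy

theorem convex_closure_of_forall {S : Set X}
    (h : ∀ x ∈ S, ∀ y ∈ S, ∀ a b : ℝ, 0 ≤ a → 0 ≤ b → a + b = 1 → a • x + b • y ∈ closure S) :
    Convex ℝ (closure S) := by
  intro x hx y hy a b ha hb hab
  have := map_mem_closure₂ (f := fun x y => a • x + b • y) (u := closure S) (by fun_prop) hx hy
    fun x hx y hy => h x hx y hy a b ha hb hab
  simpa using this

variable [CompleteSpace X]

/-- The factor `l` expresses monotonicity through the error `n = l • x`. -/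
theorem IsMaximallyMonotone.exists_regularization {A : X → Set X} (hA : IsMaximallyMonotone A)
    {l : ℝ} (hl : 0 < l) (w : X) : ∃ x ∈ dom A, w - l • x ∈ ran A ∧
      ∀ y, ∀ u ∈ A y, 0 ≤ inner ℝ (l • x - l • y) (w - l • x - u) := by
  obtain ⟨x, hx⟩ := hA.exists_sub_smul_mem hl w
  refine ⟨x, ⟨_, hx⟩, Set.mem_iUnion.2 ⟨x, hx⟩, fun y u hu => ?_⟩
  rw [← smul_sub, real_inner_smul_left]
  exact mul_nonneg hl.le (hA.prop x y _ hx u hu)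

theorem IsMaximallyMonotone.convex_closure_ran {A : X → Set X} (hA : IsMaximallyMonotone A) :
    Convex ℝ (closure (ran A)) := by
  refine convex_closure_of_forall fun u hu u' hu' a b ha hb hab => ?_
  obtain ⟨y, hy⟩ := Set.mem_iUnion.1 hu
  obtain ⟨y', hy'⟩ := Set.mem_iUnion.1 hu'
  set w := a • u + b • u' with hw
  refine mem_closure_of_forall_exists_norm_sq_le
    (C := -(a * inner ℝ y (w - u) + b * inner ℝ y' (w - u'))) (D := ‖a • y + b • y'‖)
    fun l hl _ => ?_
  obtain ⟨x, -, hx, hmono⟩ := hA.exists_regularization hl w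
  refine ⟨l • x, hx, ?_⟩
  set n := l • x
  have h1 := mul_nonneg ha (hmono y u hy)
  have h2 := mul_nonneg hb (hmono y' u' hy')
  -- In the weighted sum the terms `⟨n, w - u⟩` and `⟨n, w - u'⟩` cancel.
  have h3 : a * inner ℝ (n - l • y) (w - n - u) + b * inner ℝ (n - l • y') (w - n - u')
      = -‖n‖ ^ 2 - l * (a * inner ℝ y (w - u) + b * inner ℝ y' (w - u'))
        + l * inner ℝ (a • y + b • y') n := by
    have h4 : inner ℝ n w = a * inner ℝ n u + b * inner ℝ n u' := by
      rw [hw, inner_add_right, real_inner_smul_right, real_inner_smul_right]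
    have hb' : b = 1 - a := by linarith
    simp only [inner_sub_left, inner_sub_right, inner_add_left, real_inner_smul_left,
      ← real_inner_self_eq_norm_sq, h4]
    rw [hb']
    ring
  have h5 := mul_le_mul_of_nonneg_left (real_inner_le_norm (a • y + b • y') n) hl.le
  linarith

theorem IsMaximallyMonotone.mem_rec_closure_ran {A : X → Set X} (hA : IsMaximallyMonotone A)
    {u : X} {c : ℝ} (hc : ∀ x ∈ dom A, inner ℝ u x ≤ c) : u ∈ rec (closure (ran A)) := by
  refine mem_rec_closure fun w hw => ?_
  obtain ⟨y, hy⟩ := Set.mem_iUnion.1 hw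
  refine mem_closure_of_forall_exists_norm_sq_le (C := c - inner ℝ y u) (D := ‖y‖)
    fun l hl _ => ?_
  obtain ⟨x, hxd, hx, hmono⟩ := hA.exists_regularization hl (u + w)
  refine ⟨l • x, hx, ?_⟩
  have h1 := hmono y w hy
  -- The only term not visibly small is `⟨u, l • x⟩`; the bound on `dom A` makes it at most `l * c`.
  have h2 := mul_le_mul_of_nonneg_left (hc x hxd) hl.le
  rw [← real_inner_smul_right] at h2
  set n := l • x
  have h3 : inner ℝ (n - l • y) (u + w - n - w)
      = inner ℝ u n - ‖n‖ ^ 2 - l * inner ℝ y u + l * inner ℝ y n := by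
    rw [show u + w - n - w = u - n by abel]
    simp only [inner_sub_left, inner_sub_right, real_inner_smul_left,
      ← real_inner_self_eq_norm_sq]
    rw [real_inner_comm u n]
    ring
  have h4 := mul_le_mul_of_nonneg_left (real_inner_le_norm y n) hl.le
  linarith

theorem IsMaximallyMonotone.convex_closure_dom {A : X → Set X} (hA : IsMaximallyMonotone A) :
    Convex ℝ (closure (dom A)) :=
  ran_opInv A ▸ hA.inv.convex_closure_ran

theorem IsMaximallyMonotone.mem_rec_closure_dom {A : X → Set X} (hA : IsMaximallyMonotone A)
    {u : X} {c : ℝ} (hc : ∀ x ∈ ran A, inner ℝ u x ≤ c) : u ∈ rec (closure (dom A)) :=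
  ran_opInv A ▸ hA.inv.mem_rec_closure_ran (c := c) (by rwa [dom_opInv])

end Range

/-! ### Recession cones, polars and projections of 0. -/

section Cones

variable {X : Type*} [NormedAddCommGroup X] [InnerProductSpace ℝ X]

theorem polar_neg (C : Set X) : polar (-C) = -polar C := by
  ext u
  simp only [polar, Set.mem_ofPred_eq, Set.mem_neg]
  refine ⟨fun h c hc => ?_, fun h c hc => ?_⟩
  · simpa using h (-c) (by simpa using hc)
  · simpa using h (-c) hc

theorem closure_add_closure_subset {X : Type*} [NormedAddCommGroup X] (S S' : Set X) :
    closure S + closure S' ⊆ closure (S + S') := by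
  rintro _ ⟨a, ha, b, hb, rfl⟩
  exact map_mem_closure₂ continuous_add ha hb fun a ha b hb => Set.add_mem_add ha hb

theorem convex_closure_add {S S' : Set X} (h : Convex ℝ (closure S))
    (h' : Convex ℝ (closure S')) : Convex ℝ (closure (S + S')) := by
  have : closure (S + S') = closure (closure S + closure S') :=
    (closure_mono (Set.add_subset_add subset_closure subset_closure)).antisymm
      (closure_minimal (closure_add_closure_subset S S') isClosed_closure)
  rw [this]
  exact (h.add h').closure

theorem rec_closure_subset_rec_closure_add {X : Type*} [NormedAddCommGroup X] (S S' : Set X) :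
    rec (closure S) ⊆ rec (closure (S + S')) := by
  intro r hr
  refine mem_rec_closure ?_
  rintro _ ⟨a, ha, b, hb, rfl⟩
  rw [← add_assoc]
  exact closure_add_closure_subset S S'
    (Set.add_mem_add (hr a (subset_closure ha)) (subset_closure hb))

theorem rec_neg {X : Type*} [NormedAddCommGroup X] (C : Set X) : rec (-C) = -rec C := by
  ext u
  simp only [rec, Set.mem_ofPred_eq, Set.mem_neg]
  refine ⟨fun h y hy => ?_, fun h y hy => ?_⟩
  · simpa [add_comm] using h (-y) (by simpa using hy)
  · simpa [add_comm] using h (-y) hy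

theorem norm_sq_le_inner_of_isNearestPoint {C : Set X} (hC : Convex ℝ C) {p : X}
    (hp : IsNearestPoint C 0 p) {y : X} (hy : y ∈ C) : ‖p‖ ^ 2 ≤ inner ℝ p y := by
  have hinf : ‖(0 : X) - p‖ = ⨅ w : C, ‖(0 : X) - w‖ := by
    have : Nonempty C := ⟨⟨p, hp.1⟩⟩
    refine le_antisymm (le_ciInf fun w => hp.2 w w.2) ?_
    exact ciInf_le (f := fun w : C => ‖(0 : X) - w‖)
      ⟨0, by rintro _ ⟨w, rfl⟩; exact norm_nonneg _⟩ ⟨p, hp.1⟩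
  have := (norm_eq_iInf_iff_real_inner_le_zero hC hp.1).1 hinf y hy
  rw [zero_sub, inner_neg_left, inner_sub_right, real_inner_self_eq_norm_sq] at this
  linarith

theorem inner_nonneg_of_mem_rec {C : Set X} (hC : Convex ℝ C) {p : X}
    (hp : IsNearestPoint C 0 p) {r : X} (hr : r ∈ rec C) : 0 ≤ inner ℝ p r := by
  have := norm_sq_le_inner_of_isNearestPoint hC hp (hr p hp.1)
  rw [inner_add_right, real_inner_self_eq_norm_sq] at this
  linarith

/-- A linear functional bounded below on `S + S'` is bounded above, up to sign, on `S`. -/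
theorem exists_inner_neg_le_of_closure_add {S S' : Set X} (hS' : S'.Nonempty) {p : X} {c : ℝ}
    (h : ∀ y ∈ closure (S + S'), c ≤ inner ℝ p y) : ∃ c', ∀ x ∈ S, inner ℝ (-p) x ≤ c' := by
  obtain ⟨b, hb⟩ := hS'
  refine ⟨inner ℝ p b - c, fun x hx => ?_⟩
  have := h _ (subset_closure (Set.add_mem_add hx hb))
  rw [inner_add_right] at this
  rw [inner_neg_left]
  linarith

theorem isNearestPoint_inter_add {C C' : Set X} (hC : Convex ℝ C) (hC' : Convex ℝ C') {p p' : X}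
    (hp : IsNearestPoint C 0 p) (hp' : IsNearestPoint C' 0 p') (horth : inner ℝ p p' = 0)
    (hmem : p + p' ∈ C ∩ C') : IsNearestPoint (C ∩ C') 0 (p + p') := by
  refine ⟨hmem, fun y hy => ?_⟩
  have h1 := norm_sq_le_inner_of_isNearestPoint hC hp hy.1
  have h2 := norm_sq_le_inner_of_isNearestPoint hC' hp' hy.2
  have h3 := norm_add_sq_real p p'
  have h4 := real_inner_le_norm (p + p') y
  rw [inner_add_left] at h4
  simp only [zero_sub, norm_neg]
  by_contra! hlt
  nlinarith [norm_nonneg y, norm_nonneg (p + p')]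

end Cones

end DRSplit

open DRSplit in
theorem mainTheorem3 {X : Type*} [NormedAddCommGroup X] [InnerProductSpace ℝ X] [CompleteSpace X]
    (A B : X → Set X)
    (hA : DRSplit.IsMaximallyMonotone A) (hB : DRSplit.IsMaximallyMonotone B)
    (hran : closure (DRSplit.ranDisp A B) =
      closure (DRSplit.setD A B) ∩ closure (DRSplit.setR A B)) :
    -- the projections defining `v`, `v_D`, `v_R` are onto nonempty closed convex sets
    ((closure (DRSplit.ranDisp A B)).Nonempty ∧ Convex ℝ (closure (DRSplit.ranDisp A B))) ∧
    ((closure (DRSplit.setD A B)).Nonempty ∧ Convex ℝ (closure (DRSplit.setD A B))) ∧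
    ((closure (DRSplit.setR A B)).Nonempty ∧ Convex ℝ (closure (DRSplit.setR A B))) ∧
    -- (i)
    (DRSplit.vD A B ∈ DRSplit.polar (-DRSplit.rec (closure (DRSplit.dom A))) ∩
        DRSplit.polar (DRSplit.rec (closure (DRSplit.dom B))) ∧
      DRSplit.polar (-DRSplit.rec (closure (DRSplit.dom A))) ∩
          DRSplit.polar (DRSplit.rec (closure (DRSplit.dom B))) =
        (-DRSplit.polar (DRSplit.rec (closure (DRSplit.dom A)))) ∩
          DRSplit.polar (DRSplit.rec (closure (DRSplit.dom B)))) ∧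
    -- (ii)
    DRSplit.vD A B ∈ (-DRSplit.rec (closure (DRSplit.ran A))) ∩
        DRSplit.rec (closure (DRSplit.ran B)) ∧
    -- (iii)
    (DRSplit.vR A B ∈ DRSplit.polar (-DRSplit.rec (closure (DRSplit.ran A))) ∩
        DRSplit.polar (-DRSplit.rec (closure (DRSplit.ran B))) ∧
      DRSplit.polar (-DRSplit.rec (closure (DRSplit.ran A))) ∩
          DRSplit.polar (-DRSplit.rec (closure (DRSplit.ran B))) =
        -(DRSplit.polar (DRSplit.rec (closure (DRSplit.ran A))) ∩
          DRSplit.polar (DRSplit.rec (closure (DRSplit.ran B))))) ∧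
    -- (iv)
    (DRSplit.vR A B ∈ (-DRSplit.rec (closure (DRSplit.dom A))) ∩
        (-DRSplit.rec (closure (DRSplit.dom B))) ∧
      (-DRSplit.rec (closure (DRSplit.dom A))) ∩ (-DRSplit.rec (closure (DRSplit.dom B))) =
        -(DRSplit.rec (closure (DRSplit.dom A)) ∩ DRSplit.rec (closure (DRSplit.dom B)))) ∧
    -- (v)
    inner ℝ (DRSplit.vD A B) (DRSplit.vR A B) = 0 ∧
    -- (vi)
    DRSplit.vD A B + DRSplit.vR A B ∈
      closure (DRSplit.dom A - DRSplit.dom B) ∩ closure (DRSplit.ran A + DRSplit.ran B) ∧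
    -- (vii)
    DRSplit.v A B = DRSplit.vD A B + DRSplit.vR A B ∧
    -- (viii)
    (‖DRSplit.v A B‖ ^ 2 = ‖DRSplit.vD A B‖ ^ 2 + ‖DRSplit.vR A B‖ ^ 2 ∧
      ‖DRSplit.vD A B‖ ^ 2 + ‖DRSplit.vR A B‖ ^ 2 =
        ‖WithLp.toLp 2 (DRSplit.vR A B, DRSplit.vD A B)‖ ^ 2) := by
  have hDeq : setD A B = dom A + -dom B := sub_eq_add_neg _ _
  have hcD : Convex ℝ (closure (setD A B)) := by
    rw [hDeq]
    refine convex_closure_add hA.convex_closure_dom ?_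
    rw [← neg_closure]
    exact hB.convex_closure_dom.neg
  have hcR : Convex ℝ (closure (setR A B)) :=
    convex_closure_add hA.convex_closure_ran hB.convex_closure_ran
  have hcv : Convex ℝ (closure (ranDisp A B)) := hran ▸ hcD.inter hcR
  obtain ⟨xA, uA, huA⟩ := hA.exists_mem
  obtain ⟨xB, uB, huB⟩ := hB.exists_mem
  have hdA : (dom A).Nonempty := ⟨xA, uA, huA⟩
  have hdB : (dom B).Nonempty := ⟨xB, uB, huB⟩
  have hrA : (ran A).Nonempty := ⟨uA, Set.mem_iUnion.2 ⟨xA, huA⟩⟩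
  have hrB : (ran B).Nonempty := ⟨uB, Set.mem_iUnion.2 ⟨xB, huB⟩⟩
  have hnD : (closure (setD A B)).Nonempty := (hdA.sub hdB).closure
  have hnR : (closure (setR A B)).Nonempty := (hrA.add hrB).closure
  have hnv : (closure (ranDisp A B)).Nonempty := (ranDisp_nonempty hA hB).closure
  have hvD : IsNearestPoint (closure (setD A B)) 0 (vD A B) :=
    proj_spec hnD isClosed_closure hcD 0
  have hvR : IsNearestPoint (closure (setR A B)) 0 (vR A B) :=
    proj_spec hnR isClosed_closure hcR 0
  have hlD := fun y hy => norm_sq_le_inner_of_isNearestPoint hcD hvD (y := y) hy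
  have hlR := fun y hy => norm_sq_le_inner_of_isNearestPoint hcR hvR (y := y) hy
  have hDA : rec (closure (dom A)) ⊆ rec (closure (setD A B)) :=
    hDeq ▸ rec_closure_subset_rec_closure_add _ _
  have hDB : -rec (closure (dom B)) ⊆ rec (closure (setD A B)) := by
    rw [← rec_neg, neg_closure, hDeq, add_comm]
    exact rec_closure_subset_rec_closure_add _ _
  have hRA : rec (closure (ran A)) ⊆ rec (closure (setR A B)) :=
    rec_closure_subset_rec_closure_add _ _
  have hRB : rec (closure (ran B)) ⊆ rec (closure (setR A B)) := by
    rw [setR, add_comm]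
    exact rec_closure_subset_rec_closure_add _ _
  have h1A : vD A B ∈ polar (-rec (closure (dom A))) := by
    intro c hc
    have := inner_nonneg_of_mem_rec hcD hvD (hDA hc)
    rw [inner_neg_right, real_inner_comm] at this
    linarith
  have h1B : vD A B ∈ polar (rec (closure (dom B))) := by
    intro c hc
    have := inner_nonneg_of_mem_rec hcD hvD (hDB (Set.neg_mem_neg.2 hc))
    rw [inner_neg_right, real_inner_comm] at this
    linarith
  have h2A : -vD A B ∈ rec (closure (ran A)) := by
    rw [hDeq] at hlD
    obtain ⟨c, hc⟩ := exists_inner_neg_le_of_closure_add hdB.neg hlD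
    exact hA.mem_rec_closure_ran hc
  have h2B : vD A B ∈ rec (closure (ran B)) := by
    rw [hDeq, add_comm] at hlD
    obtain ⟨c, hc⟩ := exists_inner_neg_le_of_closure_add hdA hlD
    refine hB.mem_rec_closure_ran (c := c) fun x hx => ?_
    simpa using hc (-x) (Set.neg_mem_neg.2 hx)
  have h3A : vR A B ∈ polar (-rec (closure (ran A))) := by
    intro c hc
    have := inner_nonneg_of_mem_rec hcR hvR (hRA hc)
    rw [inner_neg_right, real_inner_comm] at this
    linarith
  have h3B : vR A B ∈ polar (-rec (closure (ran B))) := by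
    intro c hc
    have := inner_nonneg_of_mem_rec hcR hvR (hRB hc)
    rw [inner_neg_right, real_inner_comm] at this
    linarith
  have h4A : -vR A B ∈ rec (closure (dom A)) := by
    obtain ⟨c, hc⟩ := exists_inner_neg_le_of_closure_add hrB hlR
    exact hA.mem_rec_closure_dom hc
  have h4B : -vR A B ∈ rec (closure (dom B)) := by
    rw [setR, add_comm] at hlR
    obtain ⟨c, hc⟩ := exists_inner_neg_le_of_closure_add hrA hlR
    exact hB.mem_rec_closure_dom hc
  have h5 : inner ℝ (vD A B) (vR A B) = 0 := by
    -- The two polar conditions give opposite signs for the inner product.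
    have ha := h1A (vR A B) h4A
    have hb := h1B _ h4B
    rw [inner_neg_left] at hb
    rw [real_inner_comm]
    linarith
  have h6 : vD A B + vR A B ∈ closure (setD A B) ∩ closure (setR A B) := by
    -- Each vector is a recession direction of the set containing the other.
    refine ⟨?_, hRB h2B _ hvR.1⟩
    rw [add_comm]
    exact hDB h4B _ hvD.1
  have h7 : v A B = vD A B + vR A B := by
    refine (existsUnique_isNearestPoint hnv isClosed_closure hcv 0).unique
      (proj_spec hnv isClosed_closure hcv 0) ?_
    rw [hran]
    exact isNearestPoint_inter_add hcD hcR hvD hvR h5 h6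
  refine ⟨⟨hnv, hcv⟩, ⟨hnD, hcD⟩, ⟨hnR, hcR⟩, ⟨⟨h1A, h1B⟩, by rw [polar_neg]⟩, ⟨h2A, h2B⟩,
    ⟨⟨h3A, h3B⟩, by rw [polar_neg, polar_neg, Set.inter_neg]⟩,
    ⟨⟨h4A, h4B⟩, by rw [Set.inter_neg]⟩, h5, h6, h7, ?_, ?_⟩
  · rw [h7, norm_add_sq_real, h5]
    ring
  · rw [WithLp.prod_norm_sq_eq_of_L2, add_comm, WithLp.toLp_fst, WithLp.toLp_snd]
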